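/- **Groups with operations.** Fix a set $\Omega_1'$ of unary operation symbols and a set $\Omega_2'$ of binary operation symbols, the latter equipped with an assignment $\star\mapsto\star^{\circ}$, and a set $E$ of identities between terms in the operations $0,-,+$ and those of $\Omega_1'\cup\Omega_2'$. A *group with operations* (of type $(\Omega_1',\Omega_2',E)$) is a group $X$, written additively but not necessarily commutative, with an operation $\omega:X\to X$ for each $\omega\in\Omega_1'$ and $\star:X\times X\to X$ for each $\star\in\Omega_2'$, satisfying all identities in $E$ and, for all $\omega\in\Omega_1'$, $\star\in\Omega_2'$, $$a\star^{\circ}b=b\star a,\qquad a\star(b+c)=a\star b+a\star c,\qquad \omega(a+b)=\omega(a)+\omega(b),\qquad \omega(a)\star b=\omega(a\star b).$$ A *subobject* is a subgroup closed under all the operations. A *topological group with operations* is a group with operations that carries a topology for which $+$, $-$ and all operations in $\Omega_1'\cup\Omega_2'$ are continuous; a *morphism* of such is a continuous group homomorphism preserving the operations in $\Omega_1'\cup\Omega_2'$. If $X$ is a topological group with operations, then $\pi_1(X,0)$ is a group with operations via $[\alpha]\star[\beta]=[\alpha\star\beta]$ (for $\star\in\Omega_2'$ and for $\star=+$) and $\omega[\alpha]=[\omega\alpha]$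 (for $\omega\in\Omega_1'$ and for $\omega=-$), where operations on loops are pointwise; its addition coincides with composition of loops. **The path-class construction.** For a space $X$, $x_0\in X$ and a subgroup $G\le\pi_1(X,x_0)$, let $\widetilde X_G$ be the set of classes $\langle\alpha\rangle_G$ of paths $\alpha$ in $X$ starting at $x_0$, where $\alpha\simeq\beta$ iff $\alpha(1)=\beta(1)$ and $[\alpha\circ\beta^{-1}]\in G$ ($\circ$ denotes concatenation, $\beta^{-1}$ the reversed path). Give $\widetilde X_G$ the topology generated by the sets $(\langle\alpha\rangle_G,U)=\{\langle\alpha\circ\lambda\rangle_G : \lambda \text{ a path in } U,\ \lambda(0)=\alpha(1)\}$, for $\alpha$ a path starting at $x_0$ and $U$ an open neighbourhood of $\alpha(1)$. Let $p:\widetilde X_G\to X$, $p(\langle\alpha\rangle_G)=\alpha(1)$, and let $\tilde x_0$ be the class of the constant path. A space $X$ is *semi-locally simply connected* if every point has an open path connected neighbourhood $U$ such that for all $x\in U$ the homomorphism $\pi_1(U,x)\to\pi_1(X,x)$ induced by the inclusion is trivial. **Theorem.** Let $X$ be a topological group with operations (of a given type $(\Omega_1',\Omega_2',E)$) whose underlying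 space is connected, locally path connected and semi-locally simply connected, and let $G$ be a subobject of $\pi_1(X,0)$. Let $p:(\widetilde X_G,\tilde 0)\to(X,0)$ be obtained by the path-class construction from $G$, viewed as a subgroup of $\pi_1(X,0)$. Then $p$ is a covering map with characteristic group $p_*(\pi_1(\widetilde X_G,\tilde 0))=G$, and the operations of $X$ lift to $\widetilde X_G$: there are operations on $\widetilde X_G$ that make it a topological group with operations of the same type (satisfying all identities in $E$), with identity element $\tilde 0$, such that $p:\widetilde X_G\to X$ is a morphism of topological groups with operations. -/

import Mathlib

open Topology

universe u v w

/-! ### Groups with operations -/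

/-- The additional operation symbols of a category of groups with operations: `un` is the set
`Ω₁'` of unary operations other than `-`, `bin` is the set `Ω₂'` of binary operations other than
`+`, and `swap` assigns to `⋆` the opposite operation `⋆°`. The group operations `0`, `-`, `+`
are not listed here; `Ω₀ = {0}`. -/
structure OpSignature where
  un : Type u
  bin : Type v
  swap : bin → bin

/-- A group, written additively and not assumed commutative, with the operations of `S`, subject
to the identities that every category of groups with operations has to impose. -/
class GroupWithOperations (S : OpSignature.{u, v}) (X : Type w) [AddGroup X] where
  un : S.un → X → X
  bin : S.bin → X → X → X
  bin_swap : ∀ (s : S.bin) (a b : X), bin (S.swap s) a b = bin s b a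
  bin_add : ∀ (s : S.bin) (a b c : X), bin s a (b + c) = bin s a b + bin s a c
  un_add : ∀ (o : S.un) (a b : X), un o (a + b) = un o a + un o b
  un_bin : ∀ (o : S.un) (s : S.bin) (a b : X), bin s (un o a) b = un o (bin s a b)

/-- Formal terms in the operations `0`, `-`, `+`, those of `S`, and variables indexed by `ℕ`. -/
inductive OpTerm (S : OpSignature.{u, v}) : Type (max u v)
  | var : ℕ → OpTerm S
  | zero : OpTerm S
  | neg : OpTerm S → OpTerm S
  | add : OpTerm S → OpTerm S → OpTerm S
  | un : S.un → OpTerm S → OpTerm S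
  | bin : S.bin → OpTerm S → OpTerm S → OpTerm S

/-- The value of a term in a group with operations, at a valuation of the variables. -/
def OpTerm.eval {S : OpSignature.{u, v}} {X : Type w} [AddGroup X] [GroupWithOperations S X]
    (x : ℕ → X) : OpTerm S → X
  | .var n => x n
  | .zero => 0
  | .neg t => -(t.eval x)
  | .add t t' => t.eval x + t'.eval x
  | .un o t => GroupWithOperations.un o (t.eval x)
  | .bin s t t' => GroupWithOperations.bin s (t.eval x) (t'.eval x)

/-- `X` satisfies every identity `t = t'` with `(t, t') ∈ E`. The pair `(S, E)` presents a category
of groups with operations: its objects are the groups with operations of type `S` satisfying `E`,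
so that its full set of identities consists of `E`, the group laws and the laws listed in
`GroupWithOperations`. -/
def SatisfiesIdentities {S : OpSignature.{u, v}} (E : Set (OpTerm S × OpTerm S))
    (X : Type w) [AddGroup X] [GroupWithOperations S X] : Prop :=
  ∀ e ∈ E, ∀ x : ℕ → X, e.1.eval x = e.2.eval x

/-- The operations of `S` are continuous. A topological group with operations is a group with
operations and a topology for which it is a topological group (`IsTopologicalAddGroup`) and the
operations of `S` are continuous. -/
class ContinuousOperations (S : OpSignature.{u, v}) (X : Type w) [AddGroup X]
    [GroupWithOperations S X] [TopologicalSpace X] : Prop where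
  continuous_un : ∀ o : S.un, Continuous (GroupWithOperations.un o : X → X)
  continuous_bin : ∀ s : S.bin, Continuous fun q : X × X => GroupWithOperations.bin s q.1 q.2

/-- Morphisms of topological groups with operations. -/
structure IsTopOpMorphism (S : OpSignature.{u, v}) {X Y : Type*}
    [AddGroup X] [GroupWithOperations S X] [TopologicalSpace X]
    [AddGroup Y] [GroupWithOperations S Y] [TopologicalSpace Y] (f : X → Y) : Prop where
  continuous : Continuous f
  map_add : ∀ a b : X, f (a + b) = f a + f b
  map_un : ∀ (o : S.un) (a : X),
    f (GroupWithOperations.un o a) = GroupWithOperations.un o (f a)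
  map_bin : ∀ (s : S.bin) (a b : X),
    f (GroupWithOperations.bin s a b) = GroupWithOperations.bin s (f a) (f b)

/-- A subobject of a group with operations: a subgroup closed under all operations. -/
structure OpSubobject (S : OpSignature.{u, v}) (X : Type w) [AddGroup X]
    [GroupWithOperations S X] extends AddSubgroup X where
  un_mem : ∀ (o : S.un) {a : X}, a ∈ carrier → GroupWithOperations.un o a ∈ carrier
  bin_mem : ∀ (s : S.bin) {a b : X}, a ∈ carrier → b ∈ carrier →
    GroupWithOperations.bin s a b ∈ carrier

theorem GroupWithOperations.un_zero {S : OpSignature.{u, v}} {X : Type w} [AddGroup X]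
    [GroupWithOperations S X] (o : S.un) : (un o (0 : X)) = 0 := by
  have h := un_add (X := X) o 0 0
  rwa [add_zero, left_eq_add] at h

theorem GroupWithOperations.bin_zero {S : OpSignature.{u, v}} {X : Type w} [AddGroup X]
    [GroupWithOperations S X] (s : S.bin) (a : X) : bin s a (0 : X) = 0 := by
  have h := bin_add (X := X) s a 0 0
  rwa [add_zero, left_eq_add] at h

/-! ### Semi-local simple connectedness -/

/-- Every point has an open path connected neighbourhood `U` such that, for each `x ∈ U`, the
inclusion induces the trivial homomorphism `π₁(U, x) → π₁(X, x)`. -/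
def IsSemilocallySimplyConnected (X : Type*) [TopologicalSpace X] : Prop :=
  ∀ y : X, ∃ U : Set X, y ∈ U ∧ IsOpen U ∧ IsPathConnected U ∧
    ∀ x : U, FundamentalGroup.map (⟨Subtype.val, continuous_subtype_val⟩ : C(U, X)) x = 1

/-! ### The covering space built from path classes -/

section Cover

variable {X : Type w} [TopologicalSpace X] {x₀ : X}

/-- `P(X, x₀)`: the paths in `X` with initial point `x₀`, together with their final points. -/
abbrev PathFrom (x₀ : X) : Type w := Σ x : X, Path x₀ x

/-- `α ≃ β` iff `α(1) = β(1)` and `[α ∘ β⁻¹] ∈ G`. -/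
def pathRel (G : Subgroup (FundamentalGroup X x₀)) (α β : PathFrom x₀) : Prop :=
  ∃ h : α.1 = β.1,
    FundamentalGroup.fromPath
      (Path.Homotopic.Quotient.mk (α.2.trans (β.2.cast rfl h).symm)) ∈ G

theorem pathRel_equivalence (G : Subgroup (FundamentalGroup X x₀)) :
    Equivalence (pathRel G) := by
  refine ⟨?_, ?_, ?_⟩
  · rintro ⟨x, α⟩
    refine ⟨rfl, ?_⟩
    have h : (Path.Homotopic.Quotient.mk (α.trans α.symm)) =
        (1 : FundamentalGroup X x₀) := by
      rw [Path.Homotopic.Quotient.mk_trans, Path.Homotopic.Quotient.mk_symm,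
        Path.Homotopic.Quotient.trans_symm]
      rfl
    exact h ▸ G.one_mem
  · rintro ⟨x, α⟩ ⟨y, β⟩ ⟨h, hG⟩
    obtain rfl : x = y := h
    refine ⟨rfl, ?_⟩
    have h := G.inv_mem hG
    rw [FundamentalGroup.inv_def] at h
    change Path.Homotopic.Quotient.mk (α.trans β.symm).symm ∈ G at h
    rw [Path.trans_symm, Path.symm_symm] at h
    exact h
  · rintro ⟨x, α⟩ ⟨y, β⟩ ⟨z, γ⟩ ⟨h, hG⟩ ⟨h', hG'⟩
    obtain rfl : x = y := h
    obtain rfl : x = z := h'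
    refine ⟨rfl, ?_⟩
    have h := G.mul_mem hG' hG
    rw [FundamentalGroup.mul_def] at h
    have e : (Path.Homotopic.Quotient.mk (α.trans β.symm)).trans
        (Path.Homotopic.Quotient.mk (β.trans γ.symm)) =
        Path.Homotopic.Quotient.mk (α.trans γ.symm) := by
      simp only [Path.Homotopic.Quotient.mk_trans, Path.Homotopic.Quotient.mk_symm]
      rw [Path.Homotopic.Quotient.trans_assoc, ← Path.Homotopic.Quotient.trans_assoc _ _
        (Path.Homotopic.Quotient.mk γ).symm, Path.Homotopic.Quotient.symm_trans,
        Path.Homotopic.Quotient.refl_trans]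
    exact e ▸ h

/-- The set of classes `⟨α⟩_G` of paths `α` starting at `x₀`. -/
def PathCover (G : Subgroup (FundamentalGroup X x₀)) : Type w :=
  Quotient (⟨pathRel G, pathRel_equivalence G⟩ : Setoid (PathFrom x₀))

namespace PathCover

variable (G : Subgroup (FundamentalGroup X x₀))

/-- The class `⟨α⟩_G`. -/
def mk (α : PathFrom x₀) : PathCover G := Quotient.mk _ α

/-- The class of the constant path. -/
def base : PathCover G := mk G ⟨x₀, Path.refl x₀⟩

/-- The projection `⟨α⟩_G ↦ α(1)`. -/
def proj : PathCover G → X := Quotient.lift (fun α => α.1) fun _ _ h => h.1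

theorem proj_base : proj G (base G) = x₀ := rfl

/-- `(⟨α⟩_G, U)`: the classes of the continuations of `α` by paths `l` lying in `U`. -/
def basic (α : PathFrom x₀) (U : Set X) : Set (PathCover G) :=
  {z | ∃ (y : X) (l : Path α.1 y), Set.range l ⊆ U ∧ z = mk G ⟨y, α.2.trans l⟩}

/-- The topology with the sets `(⟨α⟩_G, U)` as a basis, `U` an open neighbourhood of `α(1)`. -/
instance : TopologicalSpace (PathCover G) :=
  TopologicalSpace.generateFrom
    {B | ∃ (α : PathFrom x₀) (U : Set X), IsOpen U ∧ α.1 ∈ U ∧ B = basic G α U}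

end PathCover

end Cover

/-! ### The fundamental group of a topological group with operations -/

section FundamentalGroup

variable {X : Type w} [TopologicalSpace X]

/-- The loop `t ↦ f (α t)`. -/
def loopMap₁ {x₀ : X} (f : X → X) (hf : Continuous f) (h : f x₀ = x₀) (α : Path x₀ x₀) :
    Path x₀ x₀ where
  toFun t := f (α t)
  continuous_toFun := hf.comp α.continuous
  source' := by simp [h]
  target' := by simp [h]

/-- The loop `t ↦ f (α t) (β t)`. -/
def loopMap₂ {x₀ : X} (f : X → X → X) (hf : Continuous fun q : X × X => f q.1 q.2)
    (h : f x₀ x₀ = x₀) (α β : Path x₀ x₀) : Path x₀ x₀ where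
  toFun t := f (α t) (β t)
  continuous_toFun := hf.comp (α.continuous.prodMk β.continuous)
  source' := by simp [h]
  target' := by simp [h]

/-- `[α] ↦ [t ↦ f (α t)]`. -/
def fundamentalGroupMap₁ {x₀ : X} (f : X → X) (hf : Continuous f) (h : f x₀ = x₀) :
    FundamentalGroup X x₀ → FundamentalGroup X x₀ :=
  Quotient.map (loopMap₁ f hf h) (by
    rintro α β ⟨F⟩
    refine ⟨⟨⟨⟨fun q => f (F q), hf.comp F.continuous⟩, ?_, ?_⟩, ?_⟩⟩
    · intro t
      simp [loopMap₁]
    · intro t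
      simp [loopMap₁]
    · intro t x hx
      have := F.prop' t x hx
      exact congrArg f this)

/-- `([α], [β]) ↦ [t ↦ f (α t) (β t)]`. -/
def fundamentalGroupMap₂ {x₀ : X} (f : X → X → X) (hf : Continuous fun q : X × X => f q.1 q.2)
    (h : f x₀ x₀ = x₀) :
    FundamentalGroup X x₀ → FundamentalGroup X x₀ → FundamentalGroup X x₀ :=
  Quotient.map₂ (loopMap₂ f hf h) (by
    rintro α β ⟨F⟩ α' β' ⟨F'⟩
    refine ⟨⟨⟨⟨fun q => f (F q) (F' q), hf.comp (F.continuous.prodMk F'.continuous)⟩, ?_, ?_⟩,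
      ?_⟩⟩
    · intro t
      simp [loopMap₂]
    · intro t
      simp [loopMap₂]
    · intro t x hx
      have h1 := F.prop' t x hx
      have h2 := F'.prop' t x hx
      exact congrArg₂ f h1 h2)

variable [AddGroup X]

/-- `[α] + [β] = [α + β]`, with pointwise addition of loops. -/
instance fundamentalGroupAdd [IsTopologicalAddGroup X] : Add (FundamentalGroup X (0 : X)) :=
  ⟨fundamentalGroupMap₂ (· + ·) continuous_add (add_zero 0)⟩

/-- The class of the constant loop. -/
instance fundamentalGroupZero : Zero (FundamentalGroup X (0 : X)) :=
  ⟨FundamentalGroup.fromPath (Path.Homotopic.Quotient.refl 0)⟩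

/-- `-[α] = [-α]`, with pointwise negation of loops. -/
instance fundamentalGroupNeg [IsTopologicalAddGroup X] : Neg (FundamentalGroup X (0 : X)) :=
  ⟨fundamentalGroupMap₁ (- ·) continuous_neg neg_zero⟩

/-- The group structure on `π₁(X, 0)` induced by the pointwise operations on loops. It agrees with
the composition of loops; see `fundamentalGroup_add_eq_trans`. -/
instance fundamentalGroupAddGroup [IsTopologicalAddGroup X] :
    AddGroup (FundamentalGroup X (0 : X)) :=
  AddGroup.ofLeftAxioms
    (by
      rintro ⟨α⟩ ⟨β⟩ ⟨γ⟩
      exact congrArg (Quotient.mk _) (Path.ext (funext fun t => add_assoc (α t) (β t) (γ t))))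
    (by
      rintro ⟨α⟩
      exact congrArg (Quotient.mk _) (Path.ext (funext fun t => zero_add (α t))))
    (by
      rintro ⟨α⟩
      exact congrArg (Quotient.mk _) (Path.ext (funext fun t => neg_add_cancel (α t))))

/-- `π₁(X, 0)` is a group with operations, under `[α] ⋆ [β] = [α ⋆ β]` and `ω[α] = [ωα]`, where the
operations on loops are pointwise. -/
instance fundamentalGroupWithOperations (S : OpSignature.{u, v}) [GroupWithOperations S X]
    [IsTopologicalAddGroup X]
    [ContinuousOperations S X] :
    GroupWithOperations S (FundamentalGroup X (0 : X)) where
  un o := fundamentalGroupMap₁ (GroupWithOperations.un o) (ContinuousOperations.continuous_un o)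
    (GroupWithOperations.un_zero o)
  bin s := fundamentalGroupMap₂ (GroupWithOperations.bin s)
    (ContinuousOperations.continuous_bin s) (GroupWithOperations.bin_zero s 0)
  bin_swap s := by
    rintro ⟨α⟩ ⟨β⟩
    exact congrArg (Quotient.mk _) (Path.ext (funext fun t =>
      GroupWithOperations.bin_swap s (α t) (β t)))
  bin_add s := by
    rintro ⟨α⟩ ⟨β⟩ ⟨γ⟩
    exact congrArg (Quotient.mk _) (Path.ext (funext fun t =>
      GroupWithOperations.bin_add s (α t) (β t) (γ t)))
  un_add o := by
    rintro ⟨α⟩ ⟨β⟩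
    exact congrArg (Quotient.mk _) (Path.ext (funext fun t =>
      GroupWithOperations.un_add o (α t) (β t)))
  un_bin o s := by
    rintro ⟨α⟩ ⟨β⟩
    exact congrArg (Quotient.mk _) (Path.ext (funext fun t =>
      GroupWithOperations.un_bin o s (α t) (β t)))

/-- Pointwise addition of loops at `0` is, up to homotopy, their composition. -/
theorem fundamentalGroup_add_eq_trans [IsTopologicalAddGroup X]
    (a b : FundamentalGroup X (0 : X)) :
    a + b = FundamentalGroup.fromPath
      (Path.Homotopic.Quotient.trans (FundamentalGroup.toPath a) (FundamentalGroup.toPath b)) := by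
  obtain ⟨α⟩ := a
  obtain ⟨β⟩ := b
  have key : loopMap₂ (· + ·) continuous_add (add_zero (0 : X)) (α.trans (Path.refl 0))
      ((Path.refl 0).trans β) = α.trans β := by
    ext t
    simp only [loopMap₂, Path.coe_mk_mk, Path.trans_apply]
    split_ifs <;> simp
  have h1 : (Path.Homotopic.Quotient.mk α : Path.Homotopic.Quotient (0 : X) 0) =
      Path.Homotopic.Quotient.mk (α.trans (Path.refl 0)) := by
    simp
  have h2 : (Path.Homotopic.Quotient.mk β : Path.Homotopic.Quotient (0 : X) 0) =
      Path.Homotopic.Quotient.mk ((Path.refl 0).trans β) := by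
    simp
  change fundamentalGroupMap₂ (· + ·) continuous_add (add_zero (0 : X))
    (Path.Homotopic.Quotient.mk α) (Path.Homotopic.Quotient.mk β) =
    Path.Homotopic.Quotient.mk (α.trans β)
  rw [h1, h2, ← key]
  rfl

/-- A subobject of `π₁(X, 0)`, regarded as a subgroup of the fundamental group. -/
def OpSubobject.toFundamentalSubgroup {S : OpSignature.{u, v}} [GroupWithOperations S X]
    [IsTopologicalAddGroup X] [ContinuousOperations S X] (G : OpSubobject S (FundamentalGroup X (0 : X))) :
    Subgroup (FundamentalGroup X (0 : X)) where
  carrier := G.carrier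
  mul_mem' {a b} ha hb := by
    have h := G.add_mem' hb ha
    rwa [fundamentalGroup_add_eq_trans] at h
  one_mem' := G.zero_mem'
  inv_mem' {a} ha := by
    have h : a⁻¹ = -a := by
      rw [eq_neg_iff_add_eq_zero, fundamentalGroup_add_eq_trans]
      exact Path.Homotopic.Quotient.symm_trans _
    exact h ▸ G.neg_mem' ha

end FundamentalGroup

/-! ### Path classes: topology, projection and lifting of paths. -/

section PathClasses

variable {X : Type w} [TopologicalSpace X] {x₀ : X}

/-! Operations act on paths pointwise, and pointwise operations commute with concatenation and
reversal. Hence `α ⋆ α'` and `β ⋆ β'` differ by the loop `(α ∘ β⁻¹) ⋆ (α' ∘ β'⁻¹)`, and closure of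
`G` under the operations is what makes them well defined on classes (`PathCover.map₁`,
`PathCover.map₂`). Every identity already holds between representing paths, with no homotopy needed,
so it passes to classes.

The covering property then comes from group theory: `proj` is an open surjective homomorphism of
topological groups, and its kernel is discrete because small loops at `0` are null-homotopic in `X`.
No evenly covered neighbourhoods are built by hand.

For the characteristic group, a loop `γ` lifts to `t ↦ ⟨γ|[0, t]⟩`, which ends at `⟨γ⟩`; this lift
closes up exactly when `[γ] ∈ G`. -/

theorem PathFrom.ext {α β : PathFrom x₀} (h : ∀ t, α.2 t = β.2 t) : α = β := by
  obtain ⟨x, α⟩ := α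
  obtain ⟨y, β⟩ := β
  obtain rfl : x = y := by simpa using h 1
  exact congrArg _ (Path.ext (funext h))

namespace PathCover

variable (G : Subgroup (FundamentalGroup X x₀))

theorem mk_eq_iff {α β : PathFrom x₀} : mk G α = mk G β ↔ pathRel G α β := Quotient.eq

theorem exists_eq_mk (z : PathCover G) : ∃ α, z = mk G α := by
  obtain ⟨α⟩ := z
  exact ⟨α, rfl⟩

theorem mk_eq_of_quotient_eq {x : X} {α β : Path x₀ x}
    (h : Path.Homotopic.Quotient.mk α = Path.Homotopic.Quotient.mk β) :
    mk G ⟨x, α⟩ = mk G ⟨x, β⟩ := by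
  refine (mk_eq_iff G).2 ⟨rfl, ?_⟩
  have e : Path.Homotopic.Quotient.mk (α.trans β.symm) = (1 : FundamentalGroup X x₀) := by
    rw [Path.Homotopic.Quotient.mk_trans, Path.Homotopic.Quotient.mk_symm, h,
      Path.Homotopic.Quotient.trans_symm]
    rfl
  exact e ▸ G.one_mem

/-- The tail cancels: `(α ∘ l) ∘ (β ∘ l)⁻¹` is homotopic to `α ∘ β⁻¹`. -/
theorem mk_trans_congr {x y : X} {α β : Path x₀ x} (h : mk G ⟨x, α⟩ = mk G ⟨x, β⟩)
    (l : Path x y) : mk G ⟨y, α.trans l⟩ = mk G ⟨y, β.trans l⟩ := by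
  obtain ⟨_, hG⟩ := (mk_eq_iff G).1 h
  refine (mk_eq_iff G).2 ⟨rfl, ?_⟩
  have e : Path.Homotopic.Quotient.mk ((α.trans l).trans (β.trans l).symm) =
      Path.Homotopic.Quotient.mk (α.trans β.symm) := by
    rw [Path.trans_symm]
    simp only [Path.Homotopic.Quotient.mk_trans, Path.Homotopic.Quotient.mk_symm]
    rw [Path.Homotopic.Quotient.trans_assoc, ← Path.Homotopic.Quotient.trans_assoc _ _
      (Path.Homotopic.Quotient.mk β).symm, Path.Homotopic.Quotient.trans_symm,
      Path.Homotopic.Quotient.refl_trans]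
  exact e ▸ hG

theorem mk_trans_assoc {x y z : X} (α : Path x₀ x) (l : Path x y) (l' : Path y z) :
    mk G ⟨z, (α.trans l).trans l'⟩ = mk G ⟨z, α.trans (l.trans l')⟩ :=
  mk_eq_of_quotient_eq G <| by
    simp only [Path.Homotopic.Quotient.mk_trans, Path.Homotopic.Quotient.trans_assoc]

theorem mk_loop_eq_base_iff (γ : Path x₀ x₀) :
    mk G ⟨x₀, γ⟩ = base G ↔ FundamentalGroup.fromPath (Path.Homotopic.Quotient.mk γ) ∈ G := by
  have e : Path.Homotopic.Quotient.mk (γ.trans (Path.refl x₀).symm) =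
      Path.Homotopic.Quotient.mk γ := by
    rw [Path.refl_symm, Path.Homotopic.Quotient.mk_trans, Path.Homotopic.Quotient.mk_refl,
      Path.Homotopic.Quotient.trans_refl]
  refine (mk_eq_iff G).trans ⟨fun ⟨_, h⟩ => ?_, fun h => ⟨rfl, ?_⟩⟩
  · exact e ▸ h
  · exact e.symm ▸ h

variable {G}

theorem mk_mem_basic {α : PathFrom x₀} {U : Set X} (hα : α.1 ∈ U) : mk G α ∈ basic G α U := by
  refine ⟨α.1, Path.refl _, ?_, mk_eq_of_quotient_eq G ?_⟩
  · rintro _ ⟨t, rfl⟩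
    exact hα
  · simp

/-- Concatenating continuations lets any member of a basic set serve as its centre. This recentring
gives both the basis property and the neighbourhood bases. -/
theorem basic_subset_of_mem {α β : PathFrom x₀} {U V : Set X} (hUV : V ⊆ U)
    (h : mk G β ∈ basic G α U) : basic G β V ⊆ basic G α U := by
  obtain ⟨x, α⟩ := α
  obtain ⟨y, β⟩ := β
  obtain ⟨y', l, hl, h⟩ := h
  obtain rfl : y = y' := congrArg (proj G) h
  rintro _ ⟨z, l', hl', rfl⟩
  refine ⟨z, l.trans l', ?_, ?_⟩
  · rw [Path.trans_range]
    exact Set.union_subset hl (hl'.trans hUV)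
  · exact (mk_trans_congr G h l').trans (mk_trans_assoc G _ _ _)

theorem proj_mem_of_mem_basic {α : PathFrom x₀} {U : Set X} {z : PathCover G}
    (h : z ∈ basic G α U) : proj G z ∈ U := by
  obtain ⟨y, l, hl, rfl⟩ := h
  exact hl ⟨1, l.target⟩

variable (G)

theorem isTopologicalBasis_basic : TopologicalSpace.IsTopologicalBasis
    {B | ∃ (α : PathFrom x₀) (U : Set X), IsOpen U ∧ α.1 ∈ U ∧ B = basic G α U} where
  exists_subset_inter := by
    rintro _ ⟨α, U, hU, -, rfl⟩ _ ⟨β, V, hV, -, rfl⟩ z ⟨hzU, hzV⟩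
    obtain ⟨γ, rfl⟩ := exists_eq_mk G z
    have hγ : γ.1 ∈ U ∩ V := ⟨proj_mem_of_mem_basic hzU, proj_mem_of_mem_basic hzV⟩
    exact ⟨_, ⟨γ, U ∩ V, hU.inter hV, hγ, rfl⟩, mk_mem_basic hγ, Set.subset_inter
      (basic_subset_of_mem Set.inter_subset_left hzU)
      (basic_subset_of_mem Set.inter_subset_right hzV)⟩
  sUnion_eq := by
    refine Set.eq_univ_of_forall fun z => ?_
    obtain ⟨γ, rfl⟩ := exists_eq_mk G z
    exact ⟨_, ⟨γ, Set.univ, isOpen_univ, trivial, rfl⟩, mk_mem_basic trivial⟩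
  eq_generateFrom := rfl

theorem nhds_mk_hasBasis (α : PathFrom x₀) :
    (𝓝 (mk G α)).HasBasis (fun U : Set X => IsOpen U ∧ α.1 ∈ U) (basic G α) := by
  refine ⟨fun s => (isTopologicalBasis_basic G).mem_nhds_iff.trans ⟨?_, ?_⟩⟩
  · rintro ⟨_, ⟨β, U, hU, -, rfl⟩, hα, hs⟩
    exact ⟨U, ⟨hU, proj_mem_of_mem_basic hα⟩, (basic_subset_of_mem subset_rfl hα).trans hs⟩
  · rintro ⟨U, ⟨hU, hα⟩, hs⟩
    exact ⟨_, ⟨α, U, hU, hα, rfl⟩, mk_mem_basic hα, hs⟩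

theorem continuous_proj : Continuous (proj G) := by
  refine continuous_iff_continuousAt.2 fun z => ?_
  obtain ⟨α, rfl⟩ := exists_eq_mk G z
  refine ((nhds_mk_hasBasis G α).tendsto_iff (nhds_basis_opens _)).2 fun U hU => ?_
  exact ⟨U, ⟨hU.2, hU.1⟩, fun _ => proj_mem_of_mem_basic⟩

theorem surjective_proj [PathConnectedSpace X] : Function.Surjective (proj G) :=
  fun x => ⟨mk G ⟨x, PathConnectedSpace.somePath x₀ x⟩, rfl⟩

/-- Reduces openness of `proj` to openness of path components of open sets, that is, to local path
connectedness. -/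
theorem image_proj_basic (α : PathFrom x₀) (U : Set X) :
    proj G '' basic G α U = pathComponentIn U α.1 := by
  ext y
  constructor
  · rintro ⟨_, ⟨y, l, hl, rfl⟩, rfl⟩
    exact ⟨l, fun t => hl ⟨t, rfl⟩⟩
  · rintro ⟨l, hl⟩
    exact ⟨_, ⟨y, l, Set.range_subset_iff.2 hl, rfl⟩, rfl⟩

theorem isOpenMap_proj [LocallyPathConnectedSpace X] : IsOpenMap (proj G) := by
  refine (isTopologicalBasis_basic G).isOpenMap_iff.2 ?_
  rintro _ ⟨α, U, hU, -, rfl⟩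
  rw [image_proj_basic]
  exact hU.pathComponentIn _

theorem isOpenQuotientMap_proj [PathConnectedSpace X] [LocallyPathConnectedSpace X] :
    IsOpenQuotientMap (proj G) :=
  ⟨surjective_proj G, continuous_proj G, isOpenMap_proj G⟩

/-- The lift `t ↦ ⟨γ|[0, t]⟩` of a path `γ`. -/
def liftFrom {x : X} (γ : Path x₀ x) : Path (base G) (mk G ⟨x, γ⟩) where
  toFun t := mk G ⟨γ t, (γ.subpath 0 t).cast γ.source.symm rfl⟩
  continuous_toFun := by
    refine continuous_iff_continuousAt.2 fun t => ?_
    refine (nhds_mk_hasBasis G _).tendsto_right_iff.2 fun U hU => ?_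
    -- The whole segment between `t` and `t'` shrinks to `t`, so `γ` eventually maps it into `U`.
    have h : ∀ᶠ t' in 𝓝 t, Set.uIcc t t' ⊆ γ ⁻¹' U :=
      (tendsto_const_nhds.uIcc Filter.tendsto_id).eventually
        (Filter.eventually_smallSets_subset.2 (γ.continuous.continuousAt (hU.1.mem_nhds hU.2)))
    filter_upwards [h] with t' ht'
    refine ⟨γ t', γ.subpath t t', ?_, mk_eq_of_quotient_eq G ?_⟩
    · rw [Path.range_subpath]
      exact Set.image_subset_iff.2 ht'
    -- `γ|[0, t]` followed by `γ|[t, t']` is homotopic to `γ|[0, t']`.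
    · refine (Path.Homotopic.Quotient.eq.2 ?_).symm
      exact Path.Homotopic.pathCast ⟨Path.Homotopy.subpathTransSubpath γ 0 t t'⟩
        γ.source.symm rfl
  source' := by
    refine congrArg (mk G) (PathFrom.ext fun s => ?_)
    simp [Path.subpath]
  target' := by
    refine congrArg (mk G) (PathFrom.ext fun s => ?_)
    simp [Path.subpath]

theorem range_mapOfEq_proj (hp : IsCoveringMap (proj G)) :
    (FundamentalGroup.mapOfEq (x := base G) ⟨proj G, hp.continuous⟩ (proj_base G)).range = G := by
  ext c
  constructor
  · rintro ⟨Δ, rfl⟩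
    rw [FundamentalGroup.mapOfEq_apply]
    obtain ⟨δ, rfl⟩ := Path.Homotopic.Quotient.mk_surjective Δ
    refine (mk_loop_eq_base_iff G (δ.map hp.continuous)).1 ?_
    -- `δ` and the explicit lift of its projection start at `base G` over the same loop, so
    -- monodromy forces equal endpoints: `base G` and the class of the projected loop.
    have h₁ := hp.monodromy_map (.mk δ)
    have h₂ := hp.monodromy_map (.mk (liftFrom G (δ.map hp.continuous)))
    exact congrArg Subtype.val (h₂.symm.trans h₁)
  · intro hc
    obtain ⟨γ, rfl⟩ := Path.Homotopic.Quotient.mk_surjective c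
    have h := (mk_loop_eq_base_iff G γ).2 hc
    -- As `⟨γ⟩` is the base point, the explicit lift is a loop; it projects to `γ` by definition.
    refine ⟨.mk ((liftFrom G γ).cast rfl h.symm), ?_⟩
    rw [FundamentalGroup.mapOfEq_apply]
    rfl

end PathCover

end PathClasses

/-! ### Pointwise operations on path classes. -/

section PointwiseOperations

variable {X : Type w} [TopologicalSpace X] {x₀ : X}

/-- A class over `x₀` in this basic set is represented by a loop inside `U`, which is null-homotopic
in `X`. This isolates the base point in its fibre. -/
theorem PathCover.exists_basic_base_inter_fiber_subset (hX : IsSemilocallySimplyConnected X)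
    (G : Subgroup (FundamentalGroup X x₀)) :
    ∃ U : Set X, IsOpen U ∧ x₀ ∈ U ∧
      ∀ z ∈ basic G ⟨x₀, Path.refl x₀⟩ U, proj G z = x₀ → z = base G := by
  obtain ⟨U, hx₀, hU, -, h⟩ := hX x₀
  refine ⟨U, hU, hx₀, ?_⟩
  rintro _ ⟨y, l, hl, rfl⟩ hy
  obtain rfl : y = x₀ := hy
  let l' : Path (⟨y, hx₀⟩ : U) ⟨y, hx₀⟩ :=
    { toFun := fun t => ⟨l t, hl ⟨t, rfl⟩⟩
      continuous_toFun := l.continuous.subtype_mk _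
      source' := Subtype.ext l.source
      target' := Subtype.ext l.target }
  have h1 : Path.Homotopic.Quotient.mk l = Path.Homotopic.Quotient.refl y :=
    congrArg (fun φ => φ (FundamentalGroup.fromPath (Path.Homotopic.Quotient.mk l')))
      (h ⟨y, hx₀⟩)
  refine mk_eq_of_quotient_eq G ?_
  rw [Path.Homotopic.Quotient.mk_trans, h1, Path.Homotopic.Quotient.trans_refl]

/-- The path `t ↦ f (α t)`. -/
def PathFrom.map₁ (f : X → X) (hf : Continuous f) (h : f x₀ = x₀) (α : PathFrom x₀) :
    PathFrom x₀ :=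
  ⟨f α.1,
    { toFun := fun t => f (α.2 t)
      continuous_toFun := hf.comp α.2.continuous
      source' := by simp [h]
      target' := by simp }⟩

/-- The path `t ↦ f (α t) (β t)`. -/
def PathFrom.map₂ (f : X → X → X) (hf : Continuous fun q : X × X => f q.1 q.2)
    (h : f x₀ x₀ = x₀) (α β : PathFrom x₀) : PathFrom x₀ :=
  ⟨f α.1 β.1,
    { toFun := fun t => f (α.2 t) (β.2 t)
      continuous_toFun := hf.comp (α.2.continuous.prodMk β.2.continuous)
      source' := by simp [h]
      target' := by simp }⟩

namespace PathCover

variable {G : Subgroup (FundamentalGroup X x₀)}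

/-- `⟨α⟩ ↦ ⟨t ↦ f (α t)⟩`. -/
def map₁ (f : X → X) (hf : Continuous f) (h : f x₀ = x₀)
    (hG : ∀ c ∈ G, fundamentalGroupMap₁ f hf h c ∈ G) : PathCover G → PathCover G :=
  Quotient.map (PathFrom.map₁ f hf h) <| by
    rintro ⟨x, α⟩ ⟨y, β⟩ ⟨e, hα⟩
    obtain rfl : x = y := e
    refine ⟨rfl, ?_⟩
    have key : loopMap₁ f hf h (α.trans β.symm) =
        (PathFrom.map₁ f hf h ⟨x, α⟩).2.trans (PathFrom.map₁ f hf h ⟨x, β⟩).2.symm := by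
      ext t
      simp only [loopMap₁, PathFrom.map₁, Path.coe_mk_mk, Path.trans_apply, Path.symm_apply]
      split_ifs <;> rfl
    have := hG _ hα
    change Path.Homotopic.Quotient.mk (loopMap₁ f hf h (α.trans β.symm)) ∈ G at this
    rwa [key] at this

/-- `(⟨α⟩, ⟨β⟩) ↦ ⟨t ↦ f (α t) (β t)⟩`. -/
def map₂ (f : X → X → X) (hf : Continuous fun q : X × X => f q.1 q.2) (h : f x₀ x₀ = x₀)
    (hG : ∀ c ∈ G, ∀ d ∈ G, fundamentalGroupMap₂ f hf h c d ∈ G) :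
    PathCover G → PathCover G → PathCover G :=
  Quotient.map₂ (PathFrom.map₂ f hf h) <| by
    rintro ⟨x, α⟩ ⟨y, β⟩ ⟨e, hα⟩ ⟨x', α'⟩ ⟨y', β'⟩ ⟨e', hα'⟩
    obtain rfl : x = y := e
    obtain rfl : x' = y' := e'
    refine ⟨rfl, ?_⟩
    have key : loopMap₂ f hf h (α.trans β.symm) (α'.trans β'.symm) =
        (PathFrom.map₂ f hf h ⟨x, α⟩ ⟨x', α'⟩).2.trans
          (PathFrom.map₂ f hf h ⟨x, β⟩ ⟨x', β'⟩).2.symm := by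
      ext t
      simp only [loopMap₂, PathFrom.map₂, Path.coe_mk_mk, Path.trans_apply, Path.symm_apply]
      split_ifs <;> rfl
    have := hG _ hα _ hα'
    change Path.Homotopic.Quotient.mk
      (loopMap₂ f hf h (α.trans β.symm) (α'.trans β'.symm)) ∈ G at this
    rwa [key] at this

theorem continuous_map₁ (f : X → X) (hf : Continuous f) (h : f x₀ = x₀)
    (hG : ∀ c ∈ G, fundamentalGroupMap₁ f hf h c ∈ G) : Continuous (map₁ f hf h hG) := by
  refine continuous_iff_continuousAt.2 fun z => ?_
  obtain ⟨α, rfl⟩ := exists_eq_mk G z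
  refine ((nhds_mk_hasBasis G α).tendsto_iff
    (nhds_mk_hasBasis G (PathFrom.map₁ f hf h α))).2 fun U hU => ?_
  -- Applying `f` to `α ∘ l` gives the image of `α` continued by `f ∘ l`, which lies in `U` when `l`
  -- lies in `f ⁻¹' U`.
  refine ⟨f ⁻¹' U, ⟨hU.1.preimage hf, hU.2⟩, ?_⟩
  rintro _ ⟨y, l, hl, rfl⟩
  refine ⟨f y, l.map hf, ?_, congrArg (mk G) (PathFrom.ext fun t => ?_)⟩
  · rintro _ ⟨t, rfl⟩
    exact hl ⟨t, rfl⟩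
  · refine Eq.trans (b := f ((α.2.trans l) t)) rfl (Eq.trans ?_
      (Path.trans_apply (PathFrom.map₁ f hf h α).2 (l.map hf) t).symm)
    rw [Path.trans_apply]
    split_ifs <;> rfl

theorem continuous_map₂ (f : X → X → X) (hf : Continuous fun q : X × X => f q.1 q.2)
    (h : f x₀ x₀ = x₀) (hG : ∀ c ∈ G, ∀ d ∈ G, fundamentalGroupMap₂ f hf h c d ∈ G) :
    Continuous fun q : PathCover G × PathCover G => map₂ f hf h hG q.1 q.2 := by
  refine continuous_iff_continuousAt.2 fun ⟨z, z'⟩ => ?_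
  obtain ⟨α, rfl⟩ := exists_eq_mk G z
  obtain ⟨β, rfl⟩ := exists_eq_mk G z'
  rw [ContinuousAt, nhds_prod_eq]
  refine (((nhds_mk_hasBasis G α).prod (nhds_mk_hasBasis G β)).tendsto_iff
    (nhds_mk_hasBasis G (PathFrom.map₂ f hf h α β))).2 fun U hU => ?_
  -- A box around the two endpoints that `f` maps into `U`; continuations within its sides combine
  -- to a continuation within `U`.
  obtain ⟨V, W, hV, hW, hαV, hβW, hVW⟩ := isOpen_prod_iff.1 (hU.1.preimage hf) α.1 β.1 hU.2
  refine ⟨(V, W), ⟨⟨hV, hαV⟩, hW, hβW⟩, ?_⟩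
  rintro ⟨_, _⟩ ⟨⟨y, l, hl, rfl⟩, y', l', hl', rfl⟩
  refine ⟨f y y',
    { toFun := fun t => f (l t) (l' t)
      continuous_toFun := hf.comp (l.continuous.prodMk l'.continuous)
      source' := by simp [PathFrom.map₂]
      target' := by simp }, ?_, congrArg (mk G) (PathFrom.ext fun t => ?_)⟩
  · rintro _ ⟨t, rfl⟩
    exact hVW (Set.mk_mem_prod (hl ⟨t, rfl⟩) (hl' ⟨t, rfl⟩))
  · refine Eq.trans (b := f ((α.2.trans l) t) ((β.2.trans l') t)) rfl ?_
    simp only [Path.trans_apply]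
    split_ifs <;> rfl

end PathCover

end PointwiseOperations

/-! ### The lifted structure and the covering property. -/

section LiftedOperations

variable {S : OpSignature.{u, v}} {X : Type w} [AddGroup X] [GroupWithOperations S X]
  [TopologicalSpace X] [IsTopologicalAddGroup X] [ContinuousOperations S X]
  (G : OpSubobject S (FundamentalGroup X (0 : X)))

namespace PathCover

local instance instAdd : Add (PathCover G.toFundamentalSubgroup) :=
  ⟨map₂ (· + ·) continuous_add (add_zero 0) fun _ hc _ hd => G.add_mem' hc hd⟩

local instance instNeg : Neg (PathCover G.toFundamentalSubgroup) :=
  ⟨map₁ (- ·) continuous_neg neg_zero fun _ hc => G.neg_mem' hc⟩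

local instance instZero : Zero (PathCover G.toFundamentalSubgroup) :=
  ⟨base G.toFundamentalSubgroup⟩

local instance instAddGroup : AddGroup (PathCover G.toFundamentalSubgroup) :=
  AddGroup.ofLeftAxioms
    (by
      rintro ⟨α⟩ ⟨β⟩ ⟨γ⟩
      exact congrArg (mk _) (PathFrom.ext fun t => add_assoc (α.2 t) (β.2 t) (γ.2 t)))
    (by
      rintro ⟨α⟩
      exact congrArg (mk _) (PathFrom.ext fun t => zero_add (α.2 t)))
    (by
      rintro ⟨α⟩
      -- `-α + α` is pointwise `0`, so it is the constant path itself.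
      exact congrArg (mk _) (PathFrom.ext (β := ⟨0, Path.refl 0⟩)
        fun t => neg_add_cancel (α.2 t)))

local instance instGroupWithOperations :
    GroupWithOperations S (PathCover G.toFundamentalSubgroup) where
  un o := map₁ (GroupWithOperations.un o) (ContinuousOperations.continuous_un o)
    (GroupWithOperations.un_zero o) fun _ hc => G.un_mem o hc
  bin s := map₂ (GroupWithOperations.bin s) (ContinuousOperations.continuous_bin s)
    (GroupWithOperations.bin_zero s 0) fun _ hc _ hd => G.bin_mem s hc hd
  bin_swap s := by
    rintro ⟨α⟩ ⟨β⟩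
    exact congrArg (mk _) (PathFrom.ext fun t =>
      GroupWithOperations.bin_swap s (α.2 t) (β.2 t))
  bin_add s := by
    rintro ⟨α⟩ ⟨β⟩ ⟨γ⟩
    exact congrArg (mk _) (PathFrom.ext fun t =>
      GroupWithOperations.bin_add s (α.2 t) (β.2 t) (γ.2 t))
  un_add o := by
    rintro ⟨α⟩ ⟨β⟩
    exact congrArg (mk _) (PathFrom.ext fun t =>
      GroupWithOperations.un_add o (α.2 t) (β.2 t))
  un_bin o s := by
    rintro ⟨α⟩ ⟨β⟩
    exact congrArg (mk _) (PathFrom.ext fun t =>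
      GroupWithOperations.un_bin o s (α.2 t) (β.2 t))

local instance instIsTopologicalAddGroup :
    IsTopologicalAddGroup (PathCover G.toFundamentalSubgroup) where
  continuous_add := continuous_map₂ _ _ _ _
  continuous_neg := continuous_map₁ _ _ _ _

local instance instContinuousOperations :
    ContinuousOperations S (PathCover G.toFundamentalSubgroup) where
  continuous_un _ := continuous_map₁ _ _ _ _
  continuous_bin _ := continuous_map₂ _ _ _ _

theorem isTopOpMorphism_proj : IsTopOpMorphism S (proj G.toFundamentalSubgroup) where
  continuous := continuous_proj _
  map_add := by
    rintro ⟨α⟩ ⟨β⟩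
    rfl
  map_un := by
    rintro o ⟨α⟩
    rfl
  map_bin := by
    rintro s ⟨α⟩ ⟨β⟩
    rfl

/-- Terms are evaluated on path classes pointwise along representing paths. -/
theorem exists_eval_mk (α : ℕ → PathFrom (0 : X)) (e : OpTerm S) :
    ∃ γ : PathFrom (0 : X),
      e.eval (fun n => mk G.toFundamentalSubgroup (α n)) = mk G.toFundamentalSubgroup γ ∧
      ∀ t, γ.2 t = e.eval fun n => (α n).2 t := by
  induction e with
  | var n => exact ⟨α n, rfl, fun t => rfl⟩
  | zero => exact ⟨⟨0, Path.refl 0⟩, rfl, fun t => rfl⟩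
  | neg e ih =>
    obtain ⟨γ, h, hγ⟩ := ih
    exact ⟨PathFrom.map₁ (- ·) continuous_neg neg_zero γ, congrArg (- ·) h,
      fun t => congrArg (- ·) (hγ t)⟩
  | add e e' ih ih' =>
    obtain ⟨γ, h, hγ⟩ := ih
    obtain ⟨γ', h', hγ'⟩ := ih'
    exact ⟨PathFrom.map₂ (· + ·) continuous_add (add_zero 0) γ γ', congrArg₂ (· + ·) h h',
      fun t => congrArg₂ (· + ·) (hγ t) (hγ' t)⟩
  | un o e ih =>
    obtain ⟨γ, h, hγ⟩ := ih
    exact ⟨PathFrom.map₁ (GroupWithOperations.un o) (ContinuousOperations.continuous_un o)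
      (GroupWithOperations.un_zero o) γ, congrArg (GroupWithOperations.un o) h,
      fun t => congrArg (GroupWithOperations.un o) (hγ t)⟩
  | bin s e e' ih ih' =>
    obtain ⟨γ, h, hγ⟩ := ih
    obtain ⟨γ', h', hγ'⟩ := ih'
    exact ⟨PathFrom.map₂ (GroupWithOperations.bin s) (ContinuousOperations.continuous_bin s)
      (GroupWithOperations.bin_zero s 0) γ γ', congrArg₂ (GroupWithOperations.bin s) h h',
      fun t => congrArg₂ (GroupWithOperations.bin s) (hγ t) (hγ' t)⟩

theorem satisfiesIdentities {E : Set (OpTerm S × OpTerm S)} (hE : SatisfiesIdentities E X) :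
    SatisfiesIdentities E (PathCover G.toFundamentalSubgroup) := by
  intro e he x
  choose α hα using fun n => exists_eq_mk G.toFundamentalSubgroup (x n)
  obtain rfl := funext hα
  obtain ⟨γ, h, hγ⟩ := exists_eval_mk G α e.1
  obtain ⟨γ', h', hγ'⟩ := exists_eval_mk G α e.2
  rw [h, h']
  -- The identity in `X` is used at each time `t`, so the two representing paths are equal.
  exact congrArg (mk _) (PathFrom.ext fun t => (hγ t).trans ((hE e he _).trans (hγ' t).symm))

/-- A quotient homomorphism of topological groups with discrete kernel is a covering map;
translations spread the local information at `0` over all of `X`. -/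
theorem isCoveringMap_proj [PathConnectedSpace X] [LocallyPathConnectedSpace X]
    (hX : IsSemilocallySimplyConnected X) : IsCoveringMap (proj G.toFundamentalSubgroup) := by
  let p : PathCover G.toFundamentalSubgroup →+ X :=
    AddMonoidHom.mk' (proj G.toFundamentalSubgroup) (isTopOpMorphism_proj G).map_add
  have hp : IsQuotientMap p := (isOpenQuotientMap_proj G.toFundamentalSubgroup).isQuotientMap
  obtain ⟨U, hU, h0, h⟩ := exists_basic_base_inter_fiber_subset hX G.toFundamentalSubgroup
  have hB : IsOpen (basic G.toFundamentalSubgroup ⟨0, Path.refl 0⟩ U) :=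
    (isTopologicalBasis_basic _).isOpen ⟨_, U, hU, h0, rfl⟩
  have hd : DiscreteTopology p.ker := by
    -- The basic set at the base point meets the kernel only in `0`, and in a topological group one
    -- open point suffices for discreteness.
    refine discreteTopology_of_isOpen_singleton_zero (isOpen_induced_iff.2 ⟨_, hB, ?_⟩)
    ext z
    refine ⟨fun hz => Subtype.ext (h z hz z.2), ?_⟩
    rintro rfl
    exact mk_mem_basic h0
  exact (hp.isAddQuotientCoveringMap_of_isDiscrete_ker_addMonoidHom
    (isDiscrete_iff_discreteTopology.2 hd)).isCoveringMap

end PathCover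

end LiftedOperations

theorem mainTheorem1 {S : OpSignature.{u, v}} (E : Set (OpTerm S × OpTerm S))
    (X : Type w) [AddGroup X] [GroupWithOperations S X] [TopologicalSpace X]
    [IsTopologicalAddGroup X] [ContinuousOperations S X] (hE : SatisfiesIdentities E X)
    [ConnectedSpace X] [LocallyPathConnectedSpace X] (hX : IsSemilocallySimplyConnected X)
    (G : OpSubobject S (FundamentalGroup X (0 : X))) :
    -- the projection is a covering map with characteristic group `G`
    (∃ hp : IsCoveringMap (PathCover.proj G.toFundamentalSubgroup),
      (FundamentalGroup.mapOfEq (x := PathCover.base G.toFundamentalSubgroup)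
        ⟨PathCover.proj G.toFundamentalSubgroup, hp.continuous⟩
        (PathCover.proj_base G.toFundamentalSubgroup)).range = G.toFundamentalSubgroup) ∧
    -- the operations lift
    ∃ (_ : AddGroup (PathCover G.toFundamentalSubgroup))
      (_ : GroupWithOperations S (PathCover G.toFundamentalSubgroup)),
      PathCover.base G.toFundamentalSubgroup = 0 ∧
      SatisfiesIdentities E (PathCover G.toFundamentalSubgroup) ∧
      IsTopologicalAddGroup (PathCover G.toFundamentalSubgroup) ∧
      ContinuousOperations S (PathCover G.toFundamentalSubgroup) ∧
      IsTopOpMorphism S (PathCover.proj G.toFundamentalSubgroup) := by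
  have : PathConnectedSpace X := pathConnectedSpace_iff_connectedSpace.2 inferInstance
  have hp := PathCover.isCoveringMap_proj G hX
  exact ⟨⟨hp, PathCover.range_mapOfEq_proj _ hp⟩, PathCover.instAddGroup G,
    PathCover.instGroupWithOperations G, rfl, PathCover.satisfiesIdentities G hE,
    PathCover.instIsTopologicalAddGroup G, PathCover.instContinuousOperations G,
    PathCover.isTopOpMorphism_proj G⟩
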